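/- An occurrence of a formula $f = p_1.p_2.\cdots.p_n$ (whose fragments $p_i$ are finite words over a set $\Delta$ of variables) in a word $w$ over an alphabet $\Sigma$ is a non-erasing morphism $h:\Delta^*\to\Sigma^*$ (the image of every variable is non-empty) such that $h(p_i)$ is a factor of $w$ for every $i$. The avoidability index $\lambda(f)$ is the least $k$ such that there exists an infinite word over the $k$-letter alphabet that contains no occurrence of $f$. Theorem. $\lambda(ABA.BCB.DCD.DED.AEA)=4$, where $A,B,C,D,E$ are five distinct variables. That is, some infinite word over a 4-letter alphabet contains no occurrence of $ABA.BCB.DCD.DED.AEA$, while every infinite word over an alphabet of at most 3 letters contains one. -/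

import Mathlib

/-- A formula over the variables `V`: a finite list of fragments, each fragment being a finite word
over the variables. The list `[p₁, …, pₙ]` stands for the formula `p₁.p₂.⋯.pₙ`. -/
abbrev PatternFormula (V : Type*) := List (List V)

/-- The finite word `u` is a factor of the (right) infinite word `w`. -/
def IsFactorOf {α : Type*} (u : List α) (w : ℕ → α) : Prop :=
  ∃ i : ℕ, ∀ (j : ℕ) (hj : j < u.length), w (i + j) = u[j]

/-- An occurrence of the formula `f` in the infinite word `w`: a non-erasing morphism, given by the
images `h X` of the variables, such that the image of every fragment is a factor of `w`. -/
def IsOccurrence {V α : Type*} (f : PatternFormula V) (w : ℕ → α) (h : V → List α) : Prop :=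
  (∀ X : V, h X ≠ []) ∧ ∀ p ∈ f, IsFactorOf (p.flatMap h) w

/-- The infinite word `w` avoids the formula `f`: it contains no occurrence of `f`. -/
def Avoids {V α : Type*} (w : ℕ → α) (f : PatternFormula V) : Prop :=
  ¬ ∃ h : V → List α, IsOccurrence f w h

/-- The formula `f` is `k`-avoidable: some infinite word over the `k`-letter alphabet avoids `f`. -/
def IsAvoidable {V : Type*} (k : ℕ) (f : PatternFormula V) : Prop :=
  ∃ w : ℕ → Fin k, Avoids w f

/-- The avoidability index of `f`: the least `k` such that `f` is `k`-avoidable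
(`⊤` if there is no such `k`). -/
noncomputable def avoidabilityIndex {V : Type*} (f : PatternFormula V) : ℕ∞ :=
  ⨅ (k : ℕ) (_ : IsAvoidable k f), (k : ℕ∞)

/-- Five variables. -/
inductive FiveVars : Type
  | A | B | C | D | E

open FiveVars in
/-- The formula `ABA.BCB.DCD.DED.AEA`. -/
def formulaC5 : PatternFormula FiveVars :=
  [[A, B, A], [B, C, B], [D, C, D], [D, E, D], [A, E, A]]

/-! ### Occurrences of words at given positions -/

/-! Four letters suffice: in the paperfolding word, a factor of length at least `2 ^ k` fixes its
position modulo `2 ^ (k + 1)` once it is known modulo `2 ^ k` (`modEq_of_occursAt_paperfolding`). In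
an occurrence of the formula, comparing repeated variables then makes every image length divisible
by `2 ^ k` for all `k`, which is absurd.

Three letters do not: by pigeonhole, any word has a factor `uvu` with `|u| = 22` that recurs further
on (`exists_recurrence`). A finite search finds in `u` a square `XX`, or `xy`, `yx`, `xex` and
`yey`. Taking `XY` in the first `u` and `YX` in the second (`X = Y` for a square), the stretch `Y⋯Y`
between the outer `X`s serves as `B`, and the gap before its next copy as `C`
(`exists_isOccurrence_of_recurrence`). -/

/-- The finite word `u` occurs in `w` at position `i`. -/
def OccursAt {α : Type*} (u : List α) (w : ℕ → α) (i : ℕ) : Prop :=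
  ∀ (j : ℕ) (hj : j < u.length), w (i + j) = u[j]

theorem occursAt_append {α : Type*} {u v : List α} {w : ℕ → α} {i : ℕ} :
    OccursAt (u ++ v) w i ↔ OccursAt u w i ∧ OccursAt v w (i + u.length) := by
  constructor
  · intro h
    refine ⟨fun j hj => ?_, fun j hj => ?_⟩
    · rw [h j (by simp; omega), List.getElem_append_left hj]
    · rw [add_assoc, h (u.length + j) (by simp; omega), List.getElem_append_right (by omega)]
      simp
  · rintro ⟨hu, hv⟩ j hj
    rcases lt_or_ge j u.length with hl | hl
    · rw [List.getElem_append_left hl, hu j hl]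
    · rw [List.getElem_append_right hl, ← hv (j - u.length) (by simp at hj; omega)]
      congr 1
      omega

/-- The factor of length `n` of `w` starting at position `i`. -/
def factorAt {α : Type*} (w : ℕ → α) (i n : ℕ) : List α :=
  List.ofFn fun j : Fin n => w (i + j)

@[simp]
theorem length_factorAt {α : Type*} (w : ℕ → α) (i n : ℕ) : (factorAt w i n).length = n := by
  simp [factorAt]

theorem factorAt_ne_nil {α : Type*} (w : ℕ → α) (i : ℕ) {n : ℕ} (hn : 0 < n) :
    factorAt w i n ≠ [] :=
  List.ne_nil_of_length_pos (by simpa using hn)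

theorem occursAt_factorAt_iff {α : Type*} {w : ℕ → α} {i n k : ℕ} :
    OccursAt (factorAt w i n) w k ↔ ∀ j < n, w (k + j) = w (i + j) := by
  simp [OccursAt, factorAt]

theorem occursAt_factorAt {α : Type*} (w : ℕ → α) (i n : ℕ) : OccursAt (factorAt w i n) w i :=
  occursAt_factorAt_iff.2 fun _ _ => rfl

theorem occursAt_singleton {α : Type*} {a : α} {w : ℕ → α} {i : ℕ} :
    OccursAt [a] w i ↔ w i = a := by
  simp [OccursAt]

theorem isFactorOf_flatMap_palindrome {V α : Type*} {h : V → List α} {X Y : V} {w : ℕ → α} :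
    IsFactorOf ([X, Y, X].flatMap h) w ↔ ∃ i, OccursAt (h X) w i ∧
      OccursAt (h Y) w (i + (h X).length) ∧
      OccursAt (h X) w (i + (h X).length + (h Y).length) := by
  have : ∀ i, OccursAt ([X, Y, X].flatMap h) w i ↔ OccursAt (h X) w i ∧
      OccursAt (h Y) w (i + (h X).length) ∧
      OccursAt (h X) w (i + (h X).length + (h Y).length) := by
    intro i
    simp only [List.flatMap_cons, List.flatMap_nil, List.append_nil, occursAt_append]
  exact exists_congr this

theorem isOccurrence_formulaC5_iff {α : Type*} {w : ℕ → α} {h : FiveVars → List α} :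
    IsOccurrence formulaC5 w h ↔ (∀ X, h X ≠ []) ∧
      IsFactorOf ([.A, .B, .A].flatMap h) w ∧ IsFactorOf ([.B, .C, .B].flatMap h) w ∧
      IsFactorOf ([.D, .C, .D].flatMap h) w ∧ IsFactorOf ([.D, .E, .D].flatMap h) w ∧
      IsFactorOf ([.A, .E, .A].flatMap h) w := by
  simp only [IsOccurrence, formulaC5, List.forall_mem_cons, List.not_mem_nil, false_imp_iff,
    implies_true, and_true]

/-! ### A word over four letters avoiding the formula -/

/-- The letter at the positive position `n = 2 ^ v * m`, with `m` odd, of the paperfolding word over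
four letters: it records the parity of `n` and the residue of `m` modulo `4`. -/
def paperfoldingLetter (n : ℕ) : Fin 4 :=
  ⟨(ordCompl[2] n % 4) / 2 + 2 * ((n + 1) % 2), by omega⟩

/-- The paperfolding word over four letters. -/
def paperfolding (i : ℕ) : Fin 4 := paperfoldingLetter (i + 1)

theorem mod_two_eq_of_paperfoldingLetter_eq {m n : ℕ}
    (h : paperfoldingLetter m = paperfoldingLetter n) : m % 2 = n % 2 := by
  simp only [paperfoldingLetter, Fin.mk.injEq] at h
  omega

theorem ordCompl_two_pow_mul {k m : ℕ} (hm : m % 2 = 1) : ordCompl[2] (2 ^ k * m) = m :=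
  Nat.ordCompl_pow_mul_of_not_dvd k Nat.prime_two (by omega)

theorem mod_four_eq_of_paperfoldingLetter_eq {k m n : ℕ} (hm : m % 2 = 1) (hn : n % 2 = 1)
    (h : paperfoldingLetter (2 ^ k * m) = paperfoldingLetter (2 ^ k * n)) : m % 4 = n % 4 := by
  simp only [paperfoldingLetter, Fin.mk.injEq, ordCompl_two_pow_mul hm,
    ordCompl_two_pow_mul hn] at h
  omega

/-- A factor of length at least `2 ^ k` of the paperfolding word that occurs at two positions
congruent modulo `2 ^ k` determines them modulo `2 ^ (k + 1)`. -/
theorem modEq_of_occursAt_paperfolding {k i j : ℕ} {u : List (Fin 4)} (hu : 2 ^ k ≤ u.length)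
    (hij : i ≡ j [MOD 2 ^ k]) (hi : OccursAt u paperfolding i) (hj : OccursAt u paperfolding j) :
    i ≡ j [MOD 2 ^ (k + 1)] := by
  have key : ∀ o < 2 ^ k, paperfoldingLetter (i + o + 1) = paperfoldingLetter (j + o + 1) :=
    fun o ho => (hi o (by omega)).trans (hj o (by omega)).symm
  cases k with
  | zero =>
    have := mod_two_eq_of_paperfoldingLetter_eq (key 0 (by simp))
    simp only [Nat.ModEq, zero_add, pow_one]
    omega
  | succ k =>
    obtain ⟨K, hK⟩ : ∃ K, K = 2 ^ k := ⟨_, rfl⟩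
    have hKpos : 0 < K := hK ▸ by positivity
    have e1 : 2 ^ (k + 1) = K * 2 := by rw [hK, pow_succ]
    have e2 : 2 ^ (k + 1 + 1) = K * 4 := by rw [hK, pow_succ, pow_succ]; ring
    rw [e1] at hij key
    rw [e2]
    -- Any `2K` consecutive positions include an odd multiple of `K = 2 ^ k`; its letter reveals the
    -- odd part modulo `4`, hence the position modulo `4K`.
    obtain ⟨o, ho, m, hm⟩ : ∃ o < K * 2, ∃ m, i + o + 1 = K * (2 * m + 1) := by
      -- The residue of `K - 1 - i` modulo `2K`, with `2K` added so that the subtraction does not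
      -- truncate.
      refine ⟨(2 * K - 1 + K - i % (2 * K)) % (2 * K), ?_, ?_⟩
      · rw [mul_comm]; exact Nat.mod_lt _ (by omega)
      · have hlt : i % (2 * K) < 2 * K := Nat.mod_lt _ (by omega)
        have hd := Nat.div_add_mod i (2 * K)
        rcases lt_or_ge (i % (2 * K)) K with h | h
        · refine ⟨i / (2 * K), ?_⟩
          have : (2 * K - 1 + K - i % (2 * K)) % (2 * K) = K - 1 - i % (2 * K) := by
            rw [show 2 * K - 1 + K - i % (2 * K) = K - 1 - i % (2 * K) + 2 * K by omega,
              Nat.add_mod_right, Nat.mod_eq_of_lt (by omega)]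
          rw [this]
          nlinarith [Nat.sub_add_cancel (show i % (2 * K) ≤ K - 1 by omega),
            Nat.sub_add_cancel (show 1 ≤ K by omega)]
        · refine ⟨i / (2 * K) + 1, ?_⟩
          have : (2 * K - 1 + K - i % (2 * K)) % (2 * K) = 2 * K - 1 + K - i % (2 * K) :=
            Nat.mod_eq_of_lt (by omega)
          rw [this]
          have h3 : 2 * K - 1 + K - i % (2 * K) + i % (2 * K) + 1 = 3 * K := by omega
          nlinarith
    obtain ⟨n, hn⟩ : ∃ n, j + o + 1 = K * (2 * n + 1) := by
      have h1 : K * 1 ≡ j + o + 1 [MOD K * 2] := by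
        refine Nat.ModEq.trans ?_ ((hij.add_right o).add_right 1)
        rw [hm]
        exact Nat.ModEq.mul_left' K (by simp [Nat.ModEq, Nat.add_mod])
      have hdvd : K ∣ j + o + 1 :=
        (h1.dvd_iff (Dvd.intro _ rfl)).1 (Dvd.intro _ rfl)
      obtain ⟨t, ht⟩ := hdvd
      rw [ht] at h1
      have h2 := Nat.ModEq.mul_left_cancel' hKpos.ne' h1
      refine ⟨t / 2, ?_⟩
      rw [ht]
      congr 1
      simp only [Nat.ModEq] at h2
      omega
    have h4 : 2 * m + 1 ≡ 2 * n + 1 [MOD 4] := by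
      refine mod_four_eq_of_paperfoldingLetter_eq (k := k) (by omega) (by omega) ?_
      rw [← hK, ← hm, ← hn]
      exact key o ho
    have h5 : i + (o + 1) ≡ j + (o + 1) [MOD K * 4] := by
      rw [← add_assoc, ← add_assoc, hm, hn]
      exact h4.mul_left' K
    exact h5.add_right_cancel' _

theorem avoids_paperfolding : Avoids paperfolding formulaC5 := by
  rintro ⟨h, hocc⟩
  obtain ⟨hne, h1, h2, h3, h4, h5⟩ := isOccurrence_formulaC5_iff.1 hocc
  simp only [isFactorOf_flatMap_palindrome] at h1 h2 h3 h4 h5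
  obtain ⟨p₁, a₁, b₁, a₂⟩ := h1
  obtain ⟨p₂, b₂, c₁, b₃⟩ := h2
  obtain ⟨p₃, d₁, c₂, d₂⟩ := h3
  obtain ⟨p₄, d₃, e₁, d₄⟩ := h4
  obtain ⟨p₅, a₃, e₂, a₄⟩ := h5
  -- The fragment positions must be carried along with the lengths: each comparison of two copies
  -- needs them congruent at the previous level.
  have main : ∀ k : ℕ, (∀ X, ((h X).length : ZMod (2 ^ k)) = 0) ∧ (p₂ : ZMod (2 ^ k)) = p₁ ∧
      (p₃ : ZMod (2 ^ k)) = p₁ ∧ (p₄ : ZMod (2 ^ k)) = p₁ ∧ (p₅ : ZMod (2 ^ k)) = p₁ := by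
    intro k
    induction k with
    | zero =>
      have : Subsingleton (ZMod (2 ^ 0)) := inferInstanceAs (Subsingleton (Fin 1))
      exact ⟨fun _ => Subsingleton.elim _ _, Subsingleton.elim _ _, Subsingleton.elim _ _,
        Subsingleton.elim _ _, Subsingleton.elim _ _⟩
    | succ k ih =>
      obtain ⟨hl, q₂, q₃, q₄, q₅⟩ := ih
      have step : ∀ (X : FiveVars) {i j : ℕ}, OccursAt (h X) paperfolding i →
          OccursAt (h X) paperfolding j → (i : ZMod (2 ^ k)) = j →
          (i : ZMod (2 ^ (k + 1))) = j := by
        intro X i j hi hj hij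
        rw [ZMod.natCast_eq_natCast_iff] at hij ⊢
        refine modEq_of_occursAt_paperfolding ?_ hij hi hj
        exact Nat.le_of_dvd (List.length_pos_iff.2 (hne X)) ((ZMod.natCast_eq_zero_iff _ _).1 (hl X))
      have r1 := step .A a₂ a₁ (by push_cast; simp only [hl]; ring)
      have r2 := step .A a₃ a₁ (by simp only [q₅])
      have r3 := step .A a₄ a₃ (by push_cast; simp only [hl]; ring)
      have r4 := step .B b₁ b₂ (by push_cast; simp only [hl, q₂]; ring)
      have r5 := step .B b₃ b₂ (by push_cast; simp only [hl]; ring)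
      have r6 := step .C c₁ c₂ (by push_cast; simp only [hl, q₂, q₃])
      have r7 := step .D d₂ d₁ (by push_cast; simp only [hl]; ring)
      have r8 := step .D d₃ d₁ (by simp only [q₃, q₄])
      have r9 := step .D d₄ d₃ (by push_cast; simp only [hl]; ring)
      have r10 := step .E e₁ e₂ (by push_cast; simp only [hl, q₄, q₅])
      push_cast at r1 r2 r3 r4 r5 r6 r7 r8 r9 r10
      -- The length relations alone (`A + B = 0`, `B + C = 0`, ... around the 5-cycle) give only `2A
      -- = 0`; the relations between positions remove the factor `2`.
      have hA : ((h .A).length : ZMod (2 ^ (k + 1))) = 0 := by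
        linear_combination r1 - r2 - r4 - r6 + r8 - r10
      have hB : ((h .B).length : ZMod (2 ^ (k + 1))) = 0 := by linear_combination r1 - hA
      have hC : ((h .C).length : ZMod (2 ^ (k + 1))) = 0 := by linear_combination r5 - hB
      have hD : ((h .D).length : ZMod (2 ^ (k + 1))) = 0 := by linear_combination r7 - hC
      have hE : ((h .E).length : ZMod (2 ^ (k + 1))) = 0 := by linear_combination r3 - hA
      refine ⟨fun X => by cases X <;> assumption, ?_, ?_, ?_, r2⟩
      · linear_combination hA - r4
      · linear_combination hA - r4 + hB - hD - r6
      · linear_combination hA - r4 + hB - hD - r6 + r8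
  have hdvd : ∀ k, 2 ^ k ∣ (h .A).length := fun k =>
    (ZMod.natCast_eq_zero_iff _ _).1 ((main k).1 .A)
  have hle := Nat.le_of_dvd (List.length_pos_iff.2 (hne .A)) (hdvd (h .A).length)
  exact absurd hle (not_le.2 Nat.lt_two_pow_self)

/-! ### Words with at most three letters -/

/-- An occurrence of the formula built from words `X`, `Y`, `E` such that `XY`, `YX`, `XEX`, `YEY`
are factors and such that the factor `Y⋯Y` read between the former two occurs again. -/
theorem exists_isOccurrence_of_recurrence {α : Type*} {w : ℕ → α} {X Y E : List α}
    (hX : X ≠ []) (hY : Y ≠ []) (hE : E ≠ []) {p q t : ℕ} (hpq : p + X.length ≤ q)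
    (hX₁ : OccursAt X w p) (hY₁ : OccursAt Y w (p + X.length))
    (hY₂ : OccursAt Y w q) (hX₂ : OccursAt X w (q + Y.length))
    (ht : q + Y.length < p + X.length + t)
    (hrec : ∀ j, p + X.length ≤ j → j < q + Y.length → w (j + t) = w j)
    (hXE : ∃ i, OccursAt (X ++ E ++ X) w i) (hYE : ∃ i, OccursAt (Y ++ E ++ Y) w i) :
    ∃ h, IsOccurrence formulaC5 w h := by
  have hYpos := List.length_pos_iff.2 hY
  -- `B` runs from the `Y` of `XY` through the `Y` of `YX`, giving `XBX`; `C` fills the gap to the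
  -- copy of `B` shifted by `t`. As `B` starts and ends with `Y`, `BCB` contains `YCY`.
  let b := p + X.length
  let c := q + Y.length
  let h : FiveVars → List α
    | .A => X
    | .B => factorAt w b (c - b)
    | .C => factorAt w c (b + t - c)
    | .D => Y
    | .E => E
  have hB : OccursAt (h .B) w b := occursAt_factorAt _ _ _
  have hB' : OccursAt (h .B) w (b + t) := occursAt_factorAt_iff.2 fun j hj => by
    rw [← hrec (b + j) (by omega) (by omega)]
    congr 1
    omega
  have hC : OccursAt (h .C) w c := occursAt_factorAt _ _ _
  have hY₃ : OccursAt Y w (b + t) := fun j hj => by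
    rw [← hY₁ j hj, ← hrec (p + X.length + j) (by omega) (by omega)]
    congr 1
    omega
  have lB : (h .B).length = c - b := length_factorAt _ _ _
  have lC : (h .C).length = b + t - c := length_factorAt _ _ _
  refine ⟨h, isOccurrence_formulaC5_iff.2 ⟨?_, ?_, ?_, ?_, ?_, ?_⟩⟩
  · rintro (_ | _ | _ | _ | _)
    exacts [hX, factorAt_ne_nil _ _ (by omega), factorAt_ne_nil _ _ (by omega), hY, hE]
  · refine isFactorOf_flatMap_palindrome.2 ⟨p, hX₁, hB, ?_⟩
    rw [lB, show p + (h .A).length + (c - b) = c by change b + (c - b) = c; omega]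
    exact hX₂
  · refine isFactorOf_flatMap_palindrome.2 ⟨b, hB, ?_, ?_⟩
    · rwa [lB, show b + (c - b) = c by omega]
    · rwa [lB, lC, show b + (c - b) + (b + t - c) = b + t by omega]
  · refine isFactorOf_flatMap_palindrome.2 ⟨q, hY₂, hC, ?_⟩
    rw [lC, show q + (h .D).length + (b + t - c) = b + t by
      change c + (b + t - c) = b + t; omega]
    exact hY₃
  · obtain ⟨i, hi⟩ := hYE
    rw [occursAt_append, occursAt_append, List.length_append, ← add_assoc] at hi
    exact isFactorOf_flatMap_palindrome.2 ⟨i, hi.1.1, hi.1.2, hi.2⟩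
  · obtain ⟨i, hi⟩ := hXE
    rw [occursAt_append, occursAt_append, List.length_append, ← add_assoc] at hi
    exact isFactorOf_flatMap_palindrome.2 ⟨i, hi.1.1, hi.1.2, hi.2⟩

/-- Every infinite word over a finite alphabet contains a factor `uvu`, with `u` of prescribed
length, that occurs again at a later, disjoint, nonadjacent position. -/
theorem exists_recurrence {α : Type*} [Finite α] (w : ℕ → α) (n : ℕ) :
    ∃ p q t : ℕ, p + n ≤ q ∧ q + n < p + t ∧ (∀ j < n, w (p + j) = w (q + j)) ∧
      ∀ j, p ≤ j → j < q + n → w (j + t) = w j := by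
  let K := Nat.card (Fin n → α)
  let M := n * (K + 1)
  obtain ⟨m, m', hne, hm⟩ :=
    -- Stride `M + 1` rather than `M` keeps equal blocks nonadjacent, so that `C` will be nonempty.
    Finite.exists_ne_map_eq_of_infinite fun (m : ℕ) (j : Fin M) => w (m * (M + 1) + j)
  wlog hlt : m < m' generalizing m m'
  · exact this m' m hne.symm hm.symm (by omega)
  obtain ⟨a, b, hab, heq⟩ : ∃ a b : Fin (K + 1), a < b ∧
      ∀ j < n, w (m * (M + 1) + a * n + j) = w (m * (M + 1) + b * n + j) := by
    have : Fintype (Fin n → α) := Fintype.ofFinite _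
    obtain ⟨a, b, hab, h⟩ := Fintype.exists_ne_map_eq_of_card_lt
      (fun (a : Fin (K + 1)) (j : Fin n) => w (m * (M + 1) + a * n + j))
      (by simp [K, Nat.card_eq_fintype_card])
    have h' : ∀ j < n, w (m * (M + 1) + a * n + j) = w (m * (M + 1) + b * n + j) :=
      fun j hj => congrFun h ⟨j, hj⟩
    rcases lt_or_gt_of_ne hab with hl | hl
    · exact ⟨a, b, hl, h'⟩
    · exact ⟨b, a, hl, fun j hj => (h' j hj).symm⟩
  obtain ⟨d, rfl⟩ := Nat.exists_eq_add_of_lt hlt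
  have hab' : (a : ℕ) * n + n ≤ b * n := by
    have : (a : ℕ) + 1 ≤ b := hab
    nlinarith
  have hbM : (b : ℕ) * n + n ≤ M := by
    have : (b : ℕ) + 1 ≤ K + 1 := b.2
    simp only [M]
    nlinarith
  have hd : M + 1 ≤ (d + 1) * (M + 1) := Nat.le_mul_of_pos_left _ (by omega)
  refine ⟨m * (M + 1) + a * n, m * (M + 1) + b * n, (d + 1) * (M + 1), by omega, by omega, heq, ?_⟩
  intro j hj₁ hj₂
  have h := congrFun hm ⟨j - m * (M + 1), by omega⟩
  simp only at h
  rw [show m * (M + 1) + (j - m * (M + 1)) = j by omega] at h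
  rw [h]
  congr 1
  have : (m + d + 1) * (M + 1) = m * (M + 1) + (d + 1) * (M + 1) := by ring
  omega

/-! ### Backtracking search over ternary words -/

/-- The prefix of length `m` of `s`, read backwards. -/
def reversedPrefix (s : ℕ → ℕ) : ℕ → List ℕ
  | 0 => []
  | m + 1 => s m :: reversedPrefix s m

/-- The two lists have length at least `r` and agree on their first `r` entries. -/
def agreeUpTo : ℕ → List ℕ → List ℕ → Bool
  | 0, _, _ => true
  | r + 1, a :: l, b :: l' => a.beq b && agreeUpTo r l l'
  | _ + 1, _, _ => false

/-- `xy` is a factor. -/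
def containsPair (x y : ℕ) : List ℕ → Bool
  | a :: b :: l => (a.beq x && b.beq y) || containsPair x y (b :: l)
  | _ => false

/-- `xex` is a factor. -/
def containsPalindrome (x e : ℕ) : List ℕ → Bool
  | a :: b :: c :: l =>
    (a.beq x && (b.beq e && c.beq x)) || containsPalindrome x e (b :: c :: l)
  | _ => false

/-- `xy`, `yx`, `xex` and `yey` are factors. -/
def containsTwins (x y e : ℕ) (l : List ℕ) : Bool :=
  containsPalindrome x e l && (containsPalindrome y e l && (containsPair x y l && containsPair y x l))

/-- Either the list starts with a square of period at most `8`, or it contains `xy`, `yx`, `xex` and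
`yey` for distinct letters `x`, `y`, `e`. -/
def isRefuted (l : List ℕ) : Bool :=
  (List.range 8).any (fun r => agreeUpTo (r + 1) l (l.drop (r + 1))) ||
    (containsTwins 0 1 2 l || (containsTwins 0 2 1 l || containsTwins 1 2 0 l))

/-- All extensions of the list by at most `n` letters among `0`, `1`, `2` meet `isRefuted`. -/
def refutesExtensions : ℕ → List ℕ → Bool
  | 0, l => isRefuted l
  | n + 1, l => isRefuted l || (refutesExtensions n (0 :: l) &&
      (refutesExtensions n (1 :: l) && refutesExtensions n (2 :: l)))

/-- Words are stored newest letter first, so extending is a `cons` and a square is caught at the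
head as soon as it is completed. Every branch closes by depth `22`. -/
theorem refutesExtensions_nil : refutesExtensions 22 [] = true := by
  decide +kernel

theorem exists_isRefuted {s : ℕ → ℕ} (hs : ∀ i, s i < 3) {n m : ℕ}
    (h : refutesExtensions n (reversedPrefix s m) = true) :
    ∃ k ≤ m + n, isRefuted (reversedPrefix s k) = true := by
  induction n generalizing m with
  | zero => exact ⟨m, by omega, h⟩
  | succ n ih =>
    simp only [refutesExtensions, Bool.or_eq_true, Bool.and_eq_true] at h
    rcases h with h | ⟨h0, h1, h2⟩
    · exact ⟨m, by omega, h⟩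
    · have : refutesExtensions n (reversedPrefix s (m + 1)) = true := by
        have := hs m
        rw [reversedPrefix]
        interval_cases s m <;> assumption
      obtain ⟨k, hk, hr⟩ := ih this
      exact ⟨k, by omega, hr⟩

theorem drop_reversedPrefix (s : ℕ → ℕ) (r m : ℕ) :
    (reversedPrefix s m).drop r = reversedPrefix s (m - r) := by
  induction r generalizing m with
  | zero => simp
  | succ r ih =>
    cases m with
    | zero => simp [reversedPrefix]
    | succ m => rw [reversedPrefix, List.drop_succ_cons, ih, Nat.add_sub_add_right]

theorem eq_of_agreeUpTo {s : ℕ → ℕ} {r m m' : ℕ}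
    (h : agreeUpTo r (reversedPrefix s m) (reversedPrefix s m') = true) :
    r ≤ m ∧ r ≤ m' ∧ ∀ j < r, s (m - r + j) = s (m' - r + j) := by
  induction r generalizing m m' with
  | zero => simp
  | succ r ih =>
    rcases m with _ | m <;> rcases m' with _ | m' <;>
      simp only [reversedPrefix, agreeUpTo, Bool.and_eq_true, Bool.false_eq_true] at h
    obtain ⟨h₁, h₂, h₃⟩ := ih h.2
    refine ⟨by omega, by omega, fun j hj => ?_⟩
    rw [Nat.add_sub_add_right, Nat.add_sub_add_right]
    rcases Nat.lt_succ_iff_lt_or_eq.1 hj with hj | rfl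
    · exact h₃ j hj
    · rw [Nat.sub_add_cancel h₁, Nat.sub_add_cancel h₂]
      exact Nat.eq_of_beq_eq_true h.1

/-- The letters come out swapped because the list is the prefix reversed. -/
theorem exists_of_containsPair {s : ℕ → ℕ} {x y m : ℕ}
    (h : containsPair x y (reversedPrefix s m) = true) :
    ∃ i, i + 1 < m ∧ s i = y ∧ s (i + 1) = x := by
  induction m with
  | zero => simp [reversedPrefix, containsPair] at h
  | succ m ih =>
    rcases m with _ | m
    · simp [reversedPrefix, containsPair] at h
    · rw [reversedPrefix, reversedPrefix, containsPair, ← reversedPrefix, Bool.or_eq_true,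
        Bool.and_eq_true] at h
      rcases h with ⟨h₁, h₂⟩ | h
      · exact ⟨m, by omega, Nat.eq_of_beq_eq_true h₂, Nat.eq_of_beq_eq_true h₁⟩
      · obtain ⟨i, hi, h⟩ := ih h
        exact ⟨i, by omega, h⟩

theorem exists_of_containsPalindrome {s : ℕ → ℕ} {x e m : ℕ}
    (h : containsPalindrome x e (reversedPrefix s m) = true) :
    ∃ i, i + 2 < m ∧ s i = x ∧ s (i + 1) = e ∧ s (i + 2) = x := by
  induction m with
  | zero => simp [reversedPrefix, containsPalindrome] at h
  | succ m ih =>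
    rcases m with _ | _ | m
    · simp [reversedPrefix, containsPalindrome] at h
    · simp [reversedPrefix, containsPalindrome] at h
    · rw [reversedPrefix, reversedPrefix, reversedPrefix, containsPalindrome, ← reversedPrefix,
        ← reversedPrefix, Bool.or_eq_true, Bool.and_eq_true, Bool.and_eq_true] at h
      rcases h with ⟨h₁, h₂, h₃⟩ | h
      · exact ⟨m, by omega, Nat.eq_of_beq_eq_true h₃, Nat.eq_of_beq_eq_true h₂,
          Nat.eq_of_beq_eq_true h₁⟩
      · obtain ⟨i, hi, h⟩ := ih h
        exact ⟨i, by omega, h⟩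

/-- Every word of length `22` over three letters contains a square, or `xy`, `yx`, `xex` and `yey`
for some letters `x`, `y`, `e`. -/
theorem exists_square_or_twins {s : ℕ → ℕ} (hs : ∀ i, s i < 3) :
    (∃ i r, 0 < r ∧ i + 2 * r ≤ 22 ∧ ∀ j < r, s (i + j) = s (i + r + j)) ∨
    ∃ a b c d, a + 1 < 22 ∧ b + 1 < 22 ∧ c + 2 < 22 ∧ d + 2 < 22 ∧ s a = s (b + 1) ∧
      s (a + 1) = s b ∧ s c = s a ∧ s (c + 2) = s a ∧ s d = s b ∧ s (d + 2) = s b ∧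
      s (c + 1) = s (d + 1) := by
  obtain ⟨m, hm, h⟩ := exists_isRefuted hs (m := 0) refutesExtensions_nil
  have twins : ∀ {x y e : ℕ}, containsTwins x y e (reversedPrefix s m) = true →
      ∃ a b c d, a + 1 < 22 ∧ b + 1 < 22 ∧ c + 2 < 22 ∧ d + 2 < 22 ∧ s a = s (b + 1) ∧
        s (a + 1) = s b ∧ s c = s a ∧ s (c + 2) = s a ∧ s d = s b ∧ s (d + 2) = s b ∧
        s (c + 1) = s (d + 1) := by
    intro x y e h
    simp only [containsTwins, Bool.and_eq_true] at h
    obtain ⟨c, hc, c₀, c₁, c₂⟩ := exists_of_containsPalindrome h.1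
    obtain ⟨d, hd, d₀, d₁, d₂⟩ := exists_of_containsPalindrome h.2.1
    obtain ⟨b, hb, b₀, b₁⟩ := exists_of_containsPair h.2.2.1
    obtain ⟨a, ha, a₀, a₁⟩ := exists_of_containsPair h.2.2.2
    refine ⟨a, b, c, d, ?_⟩
    omega
  simp only [isRefuted, Bool.or_eq_true, List.any_eq_true, drop_reversedPrefix] at h
  rcases h with ⟨r, -, h⟩ | h | h | h
  · obtain ⟨h₁, h₂, h₃⟩ := eq_of_agreeUpTo h
    refine .inl ⟨m - (r + 1) - (r + 1), r + 1, by omega, by omega, fun j hj => ?_⟩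
    rw [← h₃ j hj]
    congr 1
    omega
  all_goals exact .inr (twins h)

theorem exists_isOccurrence_of_le_three {k : ℕ} (hk : k ≤ 3) (w : ℕ → Fin k) :
    ∃ h, IsOccurrence formulaC5 w h := by
  obtain ⟨p, q, t, hpq, hqt, hrep, hrec⟩ := exists_recurrence w 22
  rcases exists_square_or_twins (s := fun i => (w (p + i) : ℕ))
      (fun i => (w (p + i)).2.trans_le hk) with ⟨i, r, hr, hi, h⟩ |
      ⟨a, b, c, d, ha, hb, hc, hd, h₁, h₂, h₃, h₄, h₅, h₆, h₇⟩
  · have hsq : ∀ j < r, w (p + (i + r + j)) = w (p + (i + j)) := fun j hj => (Fin.ext (h j hj)).symm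
    have hX : OccursAt (factorAt w (p + i) r) w (p + i) := occursAt_factorAt _ _ _
    have hX₁ : OccursAt (factorAt w (p + i) r) w (p + i + r) := occursAt_factorAt_iff.2 fun j hj => by
      rw [add_assoc p i j, ← hsq j hj]
      congr 1
      omega
    have hX₂ : OccursAt (factorAt w (p + i) r) w (q + i) := occursAt_factorAt_iff.2 fun j hj => by
      rw [add_assoc, add_assoc, hrep _ (by omega)]
    have hX₃ : OccursAt (factorAt w (p + i) r) w (q + i + r) := occursAt_factorAt_iff.2 fun j hj => by
      rw [add_assoc p i j, ← hsq j hj, hrep _ (by omega)]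
      congr 1
      omega
    -- For a square, `X = Y`, so one word `XEX` serves both fragments with `E`: it joins the first
    -- `X` of the square in the first `u` to the second `X` of its copy in the second.
    have hXBX : OccursAt (factorAt w (p + i) r ++ factorAt w (p + i + r) (q - p) ++
        factorAt w (p + i) r) w (p + i) := by
      rw [occursAt_append, occursAt_append]
      refine ⟨⟨hX, ?_⟩, ?_⟩
      · rw [length_factorAt]
        exact occursAt_factorAt _ _ _
      · rw [List.length_append, length_factorAt, length_factorAt]
        rwa [show p + i + (r + (q - p)) = q + i + r by omega]
    have hne := factorAt_ne_nil w (p + i) hr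
    refine exists_isOccurrence_of_recurrence (p := p + i) (q := q + i) (t := t) hne hne
      (factorAt_ne_nil w (p + i + r) (n := q - p) (by omega)) ?_ hX ?_ hX₂ ?_ ?_ ?_
      ⟨_, hXBX⟩ ⟨_, hXBX⟩ <;> rw [length_factorAt]
    · omega
    · exact hX₁
    · exact hX₃
    · omega
    · exact fun j hj₁ hj₂ => hrec j (by omega) (by omega)
  · simp only [Fin.val_inj] at h₁ h₂ h₃ h₄ h₅ h₆ h₇
    refine exists_isOccurrence_of_recurrence (X := [w (p + a)]) (Y := [w (p + b)])
      (E := [w (p + (c + 1))]) (p := p + a) (q := q + b) (t := t) (by simp) (by simp) (by simp)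
      ?_ ?_ ?_ ?_ ?_ ?_ ?_ ⟨p + c, ?_⟩ ⟨p + d, ?_⟩ <;>
      simp only [occursAt_append, occursAt_singleton, List.length_singleton, List.length_append]
    · omega
    · exact h₂
    · exact (hrep b (by omega)).symm
    · rw [h₁, hrep (b + 1) hb, add_assoc]
    · omega
    · exact fun j hj₁ hj₂ => hrec j (by omega) (by omega)
    · exact ⟨⟨h₃, rfl⟩, h₄⟩
    · exact ⟨⟨h₅, h₇.symm⟩, h₆⟩

theorem theoremc5 : avoidabilityIndex formulaC5 = 4 := by
  refine le_antisymm (iInf₂_le 4 ⟨paperfolding, avoids_paperfolding⟩) (le_iInf₂ fun k hk => ?_)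
  obtain ⟨w, hw⟩ := hk
  by_contra hlt
  have hk : k < 4 := by exact_mod_cast not_le.1 hlt
  exact hw (exists_isOccurrence_of_le_three (by omega) w)
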